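/- Let $d\ge 1$, let $\Delta\ge 3$ be an integer with $\Delta\ge 2d$ (so that every vertex of $\mathbb{Z}^d$ has at most $\Delta$ neighbours; for $d\ge 2$ one takes $\Delta=2d$), and let $$0<\lambda<\frac{(\Delta-1)^{\Delta-1}}{(\Delta-2)^{\Delta}} .$$ Consider $\mathbb{Z}^d$ as a graph in which $u,v$ are adjacent iff $\sum_j|u_j-v_j|=1$. For a finite $A\subset\mathbb{Z}^d$ let $Z_A=\sum_I\lambda^{|I|}$, the sum being over all independent sets $I\subseteq A$, and let $\partial A$ be the set of points of $A$ that have a neighbour outside $A$. Let $B_n=\{v:\sum_j|v_j|\le n\}$, and let $\mathbb{Z}^d_{\prec 0}$ consist of the origin and of all $v\in\mathbb{Z}^d$ whose last non-zero coordinate is negative. Recursion. For every finite $A\subset\mathbb{Z}^d$ and $v\in A$ fix an arbitrary enumeration $v_1,\dots,v_k$ of the neighbours of $v$ in $A$. Put $\Phi_A(v,0)=1$, $\Psi_A(v,0)=0$, and for $t\ge 1$ $$\Phi_A(v,t)=\Bigl(1+\lambda\prod_{i=1}^k\Phi_{A\setminus\{v,v_1,\dots,v_{i-1}\}}(v_i,t-1)\Bigr)^{-1},$$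 and likewise for $\Psi$ (an empty product is $1$). Let $\Phi(t)$ and $\Psi(t)$ be the values of $\Phi_A(0,t)$ and $\Psi_A(0,t)$ for $A=\mathbb{Z}^d_{\prec 0}\cap B_n$, where $n\ge t+1$ is arbitrary. Then the free energy $$\mathcal{P}(d,\lambda)=\lim_{n\to\infty}\frac{\log Z_{\Lambda_n}}{|\Lambda_n|}$$ exists and is the same for all increasing sequences $\Lambda_1\subset\Lambda_2\subset\cdots$ of finite subsets of $\mathbb{Z}^d$ with $0\in\Lambda_1$, $\max\{r:B_r\subset\Lambda_n\}\to\infty$ and $|\partial\Lambda_n|/|\Lambda_n|\to 0$. Moreover, for every choice of the enumerations, every integer $t\ge 0$, and every admissible $n$ in the definition of $\Phi(\cdot)$ and $\Psi(\cdot)$, $$-\log\Phi(2t)\le\mathcal{P}(d,\lambda)\le-\log\Psi(2t),$$ $$-\log\Psi(2t+1)\le\mathcal{P}(d,\lambda)\le-\log\Phi(2t+1),$$ where $-\log 0=+\infty$ (this occurs only for $\Psi(0)=0$). -/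

import Mathlib

/-- The lattice graph on `ℤ^d`: two points are adjacent iff their `ℓ¹` distance is `1`. -/
def latticeGraph (d : ℕ) : SimpleGraph (Fin d → ℤ) where
  Adj v u := ∑ j, |v j - u j| = 1
  symm := ⟨fun v u h => by simpa only [abs_sub_comm] using h⟩
  loopless := ⟨fun v h => by simp at h⟩

/-- The ball `B_r` around the origin of `ℤ^d` (graph distance in `ℤ^d` is the `ℓ¹` distance). -/
noncomputable def latticeBall (d r : ℕ) : Finset (Fin d → ℤ) :=
  (Fintype.piFinset fun _ => Finset.Icc (-(r : ℤ)) (r : ℤ)).filter fun v => ∑ j, |v j| ≤ (r : ℤ)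

/-- The lexicographic order `v ≺ u` on `ℤ^d`; the last coordinate is the most significant one. -/
def LexPrec {d : ℕ} (v u : Fin d → ℤ) : Prop :=
  ∃ k, v k < u k ∧ ∀ j, k < j → v j = u j

open Classical in
/-- The vertex set of `ℤ^d_{≺0} ∩ B_n`, where `ℤ^d_{≺0} = {u : u ≺ 0} ∪ {0}`. -/
noncomputable def halfBall (d n : ℕ) : Finset (Fin d → ℤ) :=
  (latticeBall d n).filter fun v => LexPrec v 0 ∨ v = 0

open Classical in
/-- The hard-core partition function `∑ lam ^ |I|` of the subgraph of `Γ` induced by the finite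
set `A`; the sum is over all independent sets `I ⊆ A`. -/
noncomputable def hardCoreZ {V : Type*} (Γ : SimpleGraph V) (lam : ℝ) (A : Finset V) : ℝ :=
  ∑ I ∈ A.powerset.filter (fun I : Finset V => Γ.IsIndepSet (I : Set V)), lam ^ I.card

open Classical in
/-- The inner boundary `∂A`: the points of `A` that have a neighbour outside `A`. -/
noncomputable def innerBoundary {V : Type*} (Γ : SimpleGraph V) (A : Finset V) : Finset V :=
  A.filter fun v => ∃ u, Γ.Adj v u ∧ u ∉ A

/-- An increasing sequence of finite subsets of `ℤ^d` containing the origin and eventually every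
ball, whose boundary is asymptotically negligible. -/
structure IsExhaustion (d : ℕ) (Λ : ℕ → Finset (Fin d → ℤ)) : Prop where
  zero_mem : 0 ∈ Λ 0
  mono : Monotone Λ
  ball_subset : ∀ r : ℕ, ∀ᶠ n in Filter.atTop, latticeBall d r ⊆ Λ n
  boundary : Filter.Tendsto
    (fun n => ((innerBoundary (latticeGraph d) (Λ n)).card : ℝ) / ((Λ n).card : ℝ))
    Filter.atTop (nhds 0)

/-- `p` is the free energy (pressure) of the hard-core model on `ℤ^d` with activity `lam`:
`log Z_{Λ_n} / |Λ_n| → p` along every exhaustion. -/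
def IsFreeEnergy (d : ℕ) (lam p : ℝ) : Prop :=
  ∀ Λ : ℕ → Finset (Fin d → ℤ), IsExhaustion d Λ →
    Filter.Tendsto
      (fun n => Real.log (hardCoreZ (latticeGraph d) lam (Λ n)) / ((Λ n).card : ℝ))
      Filter.atTop (nhds p)

/-- `e` enumerates neighbourhoods: for every finite set `A` and every `v ∈ A`, the list `e A v`
lists, without repetition, the neighbours of `v` in the subgraph of `Γ` induced by `A`. -/
def IsNbrEnum {V : Type*} (Γ : SimpleGraph V) (e : Finset V → V → List V) : Prop :=
  ∀ A : Finset V, ∀ v ∈ A, (e A v).Nodup ∧ ∀ u, u ∈ e A v ↔ u ∈ A ∧ Γ.Adj v u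

/-- The truncated cavity recursion on the subgraph induced by `A`, with initial value `x₀` at
depth `0`. If `e A v = [v₁, …, v_k]`, the value at `v` and depth `t + 1` is
`1 / (1 + lam * ∏ i, value at v_i and depth t in A \ {v, v₁, …, v_{i-1}})`.
For `k = 0` the product is `1` and the value is `1 / (1 + lam)`. -/
noncomputable def cavityRec {V : Type*} [DecidableEq V] (lam x₀ : ℝ)
    (e : Finset V → V → List V) : ℕ → Finset V → V → ℝ
  | 0, _, _ => x₀
  | t + 1, A, v =>
      (1 + lam * ∏ i : Fin (e A v).length,
        cavityRec lam x₀ e t ((A.erase v) \ ((e A v).take (i : ℕ)).toFinset)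
          ((e A v).get i))⁻¹

/-- `Φ(t)`, computed at the origin of `ℤ^d_{≺0} ∩ B_n`: the recursion started from `1`. -/
noncomputable def latticePhi (d : ℕ) (lam : ℝ)
    (e : Finset (Fin d → ℤ) → (Fin d → ℤ) → List (Fin d → ℤ)) (n t : ℕ) : ℝ :=
  cavityRec lam 1 e t (halfBall d n) 0

/-- `Ψ(t)`, computed at the origin of `ℤ^d_{≺0} ∩ B_n`: the recursion started from `0`. -/
noncomputable def latticePsi (d : ℕ) (lam : ℝ)
    (e : Finset (Fin d → ℤ) → (Fin d → ℤ) → List (Fin d → ℤ)) (n t : ℕ) : ℝ :=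
  cavityRec lam 0 e t (halfBall d n) 0

/-- `-log x` for `x ≥ 0`, as an extended real number; `-log 0 = +∞`. -/
noncomputable def negLog (x : ℝ) : EReal := -ENNReal.log (ENNReal.ofReal x)

/-! Bounds. Removing the vertices of `Λ` in decreasing lexicographic order writes `log Z_Λ` as the
sum of `-log` of the probability that `v` is vacant in the graph on `v` and its predecessors
(`log_hardCoreZ_eq_sum`). Vacancy probabilities satisfy the cavity recursion exactly, and one step
of it is antitone in the values at the neighbours. Starting from the trivial bounds `0` and `1`,
depth `t` therefore gives bounds that swap sides with the parity of `t` and depend only on sites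
within distance `t` (`cavityRec_bounds`). If `v` is far from the complement of `Λ`, its predecessors
look like the half-space, so the bounds are `Φ(t)` and `Ψ(t)` (`cavityRec_halfBall_bounds`). The
remaining sites form a collar of vanishing density, and dividing by `|Λ|` finishes.

Existence. Tile by cubes of side `M + 1`. Full tiles bound `log Z_Λ` above by submultiplicativity;
tiles shrunk by one layer are mutually non-adjacent and bound it below (`log_hardCoreZ_tiling`). The
two rates differ by a surface term, so the limit is the infimum of the upper rates. -/

section HardCore

variable {V : Type*} (Γ : SimpleGraph V) {lam : ℝ}

/-! ### Partition functions on finite vertex sets. -/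

lemma hardCoreZ_empty : hardCoreZ Γ lam ∅ = 1 := by
  classical
  simp [hardCoreZ, Finset.filter_singleton, SimpleGraph.IsIndepSet]

lemma hardCoreZ_mono (hl : 0 ≤ lam) {A B : Finset V} (h : A ⊆ B) :
    hardCoreZ Γ lam A ≤ hardCoreZ Γ lam B := by
  classical
  unfold hardCoreZ
  refine Finset.sum_le_sum_of_subset_of_nonneg ?_ fun I _ _ => pow_nonneg hl _
  exact Finset.filter_subset_filter _ (Finset.powerset_mono.2 h)

lemma one_le_hardCoreZ (hl : 0 ≤ lam) (A : Finset V) : 1 ≤ hardCoreZ Γ lam A :=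
  (hardCoreZ_empty Γ).symm.le.trans (hardCoreZ_mono Γ hl (Finset.empty_subset A))

lemma hardCoreZ_pos (hl : 0 ≤ lam) (A : Finset V) : 0 < hardCoreZ Γ lam A :=
  one_pos.trans_le (one_le_hardCoreZ Γ hl A)

open Classical in
/-- Deletion recursion: an independent set either avoids `v`, or contains `v` and none of its
neighbours. -/
lemma hardCoreZ_eq_erase_add [DecidableEq V] {A : Finset V} {v : V} (hv : v ∈ A) :
    hardCoreZ Γ lam A = hardCoreZ Γ lam (A.erase v) +
      lam * hardCoreZ Γ lam ((A.erase v).filter fun u => ¬ Γ.Adj v u) := by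
  obtain ⟨B, hB, rfl⟩ : ∃ B, v ∉ B ∧ A = insert v B :=
    ⟨A.erase v, Finset.notMem_erase v A, (Finset.insert_erase hv).symm⟩
  rw [Finset.erase_insert hB]
  have hsymm : Std.Symm fun a b => ¬ Γ.Adj a b := ⟨fun a b h h' => h h'.symm⟩
  have hset : (B.powerset.filter fun I : Finset V =>
        Γ.IsIndepSet ((insert v I : Finset V) : Set V)) =
      (B.filter fun u => ¬ Γ.Adj v u).powerset.filter
        (fun I : Finset V => Γ.IsIndepSet (I : Set V)) := by
    ext I
    simp only [Finset.mem_filter, Finset.mem_powerset, SimpleGraph.IsIndepSet, Finset.coe_insert]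
    rw [Set.pairwise_insert_of_symm]
    constructor
    · rintro ⟨hI, h1, h2⟩
      exact ⟨fun u hu => Finset.mem_filter.2
        ⟨hI hu, h2 u hu (fun h => hB (hI (h ▸ hu)))⟩, h1⟩
    · rintro ⟨hI, h1⟩
      exact ⟨fun u hu => (Finset.mem_filter.1 (hI hu)).1, h1,
        fun u hu _ => (Finset.mem_filter.1 (hI hu)).2⟩
  rw [show hardCoreZ Γ lam (B.filter fun u => ¬ Γ.Adj v u) = ∑ I ∈ B.powerset.filter
      (fun I : Finset V => Γ.IsIndepSet ((insert v I : Finset V) : Set V)), lam ^ I.card by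
    rw [hset]; unfold hardCoreZ; congr]
  unfold hardCoreZ
  simp only [Finset.sum_filter]
  have := Finset.sum_powerset_insert hB
    (fun I : Finset V => if Γ.IsIndepSet (I : Set V) then lam ^ I.card else 0)
  rw [Finset.mul_sum]
  refine (Eq.trans (Finset.sum_congr rfl fun _ _ => by congr) this).trans
    (congrArg₂ (· + ·) (Finset.sum_congr rfl fun _ _ => by congr) ?_)
  refine Finset.sum_congr rfl fun I hI => ?_
  have hvI : v ∉ I := fun h => hB (Finset.mem_powerset.1 hI h)
  rw [Finset.card_insert_of_notMem hvI, pow_succ']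
  split_ifs <;> simp

lemma hardCoreZ_le_erase [DecidableEq V] (hl : 0 ≤ lam) {A : Finset V} {v : V} (hv : v ∈ A) :
    hardCoreZ Γ lam A ≤ (1 + lam) * hardCoreZ Γ lam (A.erase v) := by
  classical
  rw [hardCoreZ_eq_erase_add Γ hv, add_mul, one_mul]
  gcongr
  exact hardCoreZ_mono Γ hl (Finset.filter_subset _ _)

lemma hardCoreZ_le_pow (hl : 0 ≤ lam) (A : Finset V) :
    hardCoreZ Γ lam A ≤ (1 + lam) ^ A.card := by
  classical
  induction A using Finset.induction_on with
  | empty => simp [hardCoreZ_empty]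
  | insert v A hv ih =>
    refine (hardCoreZ_le_erase Γ hl (Finset.mem_insert_self v A)).trans ?_
    rw [Finset.erase_insert hv, Finset.card_insert_of_notMem hv, pow_succ']
    gcongr

/-- An independent set of the union is determined by its traces on `A` and `B`. The induction
deletes vertices of `A`; since this also removes their neighbours from `B`, the statement is proved
for all `B` at once and monotonicity restores them. -/
lemma hardCoreZ_union_le [DecidableEq V] (hl : 0 ≤ lam) {A B : Finset V} (h : Disjoint A B) :
    hardCoreZ Γ lam (A ∪ B) ≤ hardCoreZ Γ lam A * hardCoreZ Γ lam B := by
  classical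
  induction A using Finset.strongInduction generalizing B with
  | H A ih =>
    obtain rfl | ⟨v, hv⟩ := A.eq_empty_or_nonempty
    · simp [hardCoreZ_empty]
    have hvB : v ∉ B := Finset.disjoint_left.1 h hv
    have hss : A.erase v ⊂ A := Finset.erase_ssubset hv
    have hss' : (A.erase v).filter (fun u => ¬ Γ.Adj v u) ⊂ A :=
      (Finset.filter_subset _ _).trans_ssubset hss
    rw [hardCoreZ_eq_erase_add Γ (Finset.mem_union_left B hv), hardCoreZ_eq_erase_add Γ hv,
      Finset.erase_union_distrib, Finset.erase_eq_of_notMem hvB, Finset.filter_union, add_mul,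
      mul_assoc]
    refine add_le_add (ih _ hss (h.mono_left hss.subset)) (mul_le_mul_of_nonneg_left ?_ hl)
    refine (ih _ hss' (h.mono hss'.subset (Finset.filter_subset _ _))).trans ?_
    exact mul_le_mul_of_nonneg_left (hardCoreZ_mono Γ hl (Finset.filter_subset _ _))
      (hardCoreZ_pos Γ hl _).le

lemma hardCoreZ_union_eq [DecidableEq V] {A B : Finset V} (h : Disjoint A B)
    (hAB : ∀ a ∈ A, ∀ b ∈ B, ¬ Γ.Adj a b) :
    hardCoreZ Γ lam (A ∪ B) = hardCoreZ Γ lam A * hardCoreZ Γ lam B := by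
  classical
  induction A using Finset.strongInduction with
  | H A ih =>
    obtain rfl | ⟨v, hv⟩ := A.eq_empty_or_nonempty
    · simp [hardCoreZ_empty]
    have hvB : v ∉ B := Finset.disjoint_left.1 h hv
    have hss : A.erase v ⊂ A := Finset.erase_ssubset hv
    have hss' : (A.erase v).filter (fun u => ¬ Γ.Adj v u) ⊂ A :=
      (Finset.filter_subset _ _).trans_ssubset hss
    rw [hardCoreZ_eq_erase_add Γ (Finset.mem_union_left B hv), hardCoreZ_eq_erase_add Γ hv,
      Finset.erase_union_distrib, Finset.erase_eq_of_notMem hvB, Finset.filter_union, add_mul,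
      mul_assoc, Finset.filter_true_of_mem (s := B) (hAB v hv),
      ih _ hss (h.mono_left hss.subset) (fun a ha => hAB a (hss.subset ha)),
      ih _ hss' (h.mono_left hss'.subset) (fun a ha => hAB a (hss'.subset ha))]

lemma hardCoreZ_map (f : Γ ≃g Γ) (A : Finset V) :
    hardCoreZ Γ lam (A.map f.toEquiv.toEmbedding) = hardCoreZ Γ lam A := by
  classical
  unfold hardCoreZ
  symm
  refine Finset.sum_bij' (fun I _ => I.map f.toEquiv.toEmbedding)
    (fun J _ => J.map f.symm.toEquiv.toEmbedding) ?_ ?_ ?_ ?_ ?_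
  · intro I hI
    rw [Finset.mem_filter, Finset.mem_powerset] at hI ⊢
    refine ⟨Finset.map_subset_map.2 hI.1, ?_⟩
    intro a ha b hb hab hadj
    simp only [Finset.coe_map, Set.mem_image, Finset.mem_coe] at ha hb
    obtain ⟨a, ha, rfl⟩ := ha
    obtain ⟨b, hb, rfl⟩ := hb
    exact hI.2 ha hb (fun h => hab (by rw [h])) (f.map_adj_iff.1 hadj)
  · intro J hJ
    rw [Finset.mem_filter, Finset.mem_powerset] at hJ ⊢
    constructor
    · intro a ha
      obtain ⟨b, hb, rfl⟩ := Finset.mem_map.1 ha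
      obtain ⟨c, hc, rfl⟩ := Finset.mem_map.1 (hJ.1 hb)
      simpa using hc
    intro a ha b hb hab hadj
    simp only [Finset.coe_map, Set.mem_image, Finset.mem_coe] at ha hb
    obtain ⟨a, ha, rfl⟩ := ha
    obtain ⟨b, hb, rfl⟩ := hb
    exact hJ.2 ha hb (fun h => hab (by rw [h])) (f.symm.map_adj_iff.1 hadj)
  · intro I _
    rw [Finset.map_map]
    convert Finset.map_refl using 2
    ext; simp
  · intro I _
    rw [Finset.map_map]
    convert Finset.map_refl using 2
    ext; simp
  · intro I _; rw [Finset.card_map]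

/-! ### Vacancy probabilities and the cavity recursion. -/

/-- The probability, in the hard-core model on `A`, that the vertex `v` is vacant. -/
noncomputable def vacancyProb [DecidableEq V] (lam : ℝ) (A : Finset V) (v : V) : ℝ :=
  hardCoreZ Γ lam (A.erase v) / hardCoreZ Γ lam A

lemma vacancyProb_pos [DecidableEq V] (hl : 0 ≤ lam) (A : Finset V) (v : V) :
    0 < vacancyProb Γ lam A v :=
  div_pos (hardCoreZ_pos Γ hl _) (hardCoreZ_pos Γ hl _)

lemma vacancyProb_le_one [DecidableEq V] (hl : 0 ≤ lam) (A : Finset V) (v : V) :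
    vacancyProb Γ lam A v ≤ 1 :=
  (div_le_one (hardCoreZ_pos Γ hl _)).2 (hardCoreZ_mono Γ hl (Finset.erase_subset _ _))

lemma inv_le_vacancyProb [DecidableEq V] (hl : 0 ≤ lam) {A : Finset V} {v : V} (hv : v ∈ A) :
    (1 + lam)⁻¹ ≤ vacancyProb Γ lam A v := by
  rw [vacancyProb, le_div_iff₀ (hardCoreZ_pos Γ hl _), inv_mul_le_iff₀ (by linarith)]
  exact hardCoreZ_le_erase Γ hl hv

lemma vacancyProb_map [DecidableEq V] (f : Γ ≃g Γ) (A : Finset V) (v : V) :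
    vacancyProb Γ lam (A.map f.toEquiv.toEmbedding) (f v) = vacancyProb Γ lam A v := by
  have : (A.map f.toEquiv.toEmbedding).erase (f v) = (A.erase v).map f.toEquiv.toEmbedding :=
    (Finset.map_erase f.toEquiv.toEmbedding A v).symm
  rw [vacancyProb, this, hardCoreZ_map, hardCoreZ_map, vacancyProb]

/-- The product telescopes: the set left after each deletion is the ambient set of the next factor.
-/
lemma prod_vacancyProb [DecidableEq V] (hl : 0 ≤ lam) (S : Finset V) (l : List V) (k : ℕ)
    (hk : k ≤ l.length) :
    ∏ i : Fin k, vacancyProb Γ lam (S \ (l.take (i : ℕ)).toFinset) (l.get (i.castLE hk)) =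
      hardCoreZ Γ lam (S \ (l.take k).toFinset) / hardCoreZ Γ lam S := by
  induction k with
  | zero => simp [div_self (hardCoreZ_pos Γ hl S).ne']
  | succ k ih =>
    rw [Fin.prod_univ_castSucc]
    have := ih (by omega)
    simp only [Fin.val_castSucc, Fin.val_last] at this ⊢
    rw [show (∏ i : Fin k, vacancyProb Γ lam (S \ (l.take (i : ℕ)).toFinset)
      (l.get (Fin.castLE hk i.castSucc))) = _ from this, vacancyProb]
    have h2 : (S \ (l.take k).toFinset).erase (l.get (Fin.castLE hk (Fin.last k))) =
        S \ (l.take (k + 1)).toFinset := by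
      ext u
      have h3 : u ∈ l.take (k + 1) ↔ u ∈ l.take k ∨ u = l[k] := by
        rw [List.take_succ_eq_append_getElem (by omega), List.mem_append, List.mem_singleton]
      simp [Fin.castLE, h3]
      tauto
    rw [h2, mul_comm, div_mul_div_cancel₀ (hardCoreZ_pos Γ hl _).ne']

/-- The cavity recursion for the vacancy probability. -/
lemma vacancyProb_eq_inv [DecidableEq V] (hl : 0 ≤ lam) {A : Finset V} {v : V} (hv : v ∈ A)
    {l : List V} (hmem : ∀ u, u ∈ l ↔ u ∈ A ∧ Γ.Adj v u) :
    vacancyProb Γ lam A v = (1 + lam * ∏ i : Fin l.length,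
      vacancyProb Γ lam ((A.erase v) \ (l.take (i : ℕ)).toFinset) (l.get i))⁻¹ := by
  classical
  have h := prod_vacancyProb Γ hl (A.erase v) l l.length le_rfl
  simp only [Fin.castLE_rfl, id] at h
  rw [h, List.take_length]
  -- Deleting `v` and all its neighbours leaves the set in the second term of the deletion
  -- recursion.
  have h2 : A.erase v \ l.toFinset = (A.erase v).filter fun u => ¬ Γ.Adj v u := by
    ext u
    simp [hmem]
    tauto
  have h0 := hardCoreZ_pos Γ hl (A.erase v)
  rw [h2, vacancyProb, hardCoreZ_eq_erase_add Γ hv]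
  have h1 := hardCoreZ_pos Γ hl ((A.erase v).filter fun u => ¬ Γ.Adj v u)
  rw [eq_comm, inv_eq_iff_eq_inv, inv_div]
  field_simp

lemma cavityRec_nonneg [DecidableEq V] (hl : 0 ≤ lam) {x : ℝ} (hx : 0 ≤ x)
    (e : Finset V → V → List V) (t : ℕ) (A : Finset V) (v : V) :
    0 ≤ cavityRec lam x e t A v := by
  induction t generalizing A v with
  | zero => simpa [cavityRec]
  | succ t ih =>
    rw [cavityRec, inv_nonneg]
    have := Finset.prod_nonneg (s := Finset.univ) fun (i : Fin (e A v).length) _ =>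
      ih ((A.erase v) \ ((e A v).take (i : ℕ)).toFinset) ((e A v).get i)
    positivity

/-- The vacancy probabilities satisfy the recursion, and one step of it reverses inequalities;
so bounds at depth `0` give alternating bounds. Here `D t v u` stands for `u` being within
distance `t` of `v`; only the part of the ambient set within distance `t` of `v` matters. -/
lemma cavityRec_bounds [DecidableEq V] (hl : 0 ≤ lam) {e : Finset V → V → List V}
    (he : IsNbrEnum Γ e) {D : ℕ → V → V → Prop} (hD0 : ∀ t v, D t v v)
    (hD : ∀ t v u w, Γ.Adj v u → D t u w → D (t + 1) v w) (t : ℕ) (A A' : Finset V) (v : V)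
    (hv : v ∈ A) (hAA' : ∀ u, D t v u → (u ∈ A ↔ u ∈ A')) :
    if Even t then cavityRec lam 0 e t A v ≤ vacancyProb Γ lam A' v ∧
        vacancyProb Γ lam A' v ≤ cavityRec lam 1 e t A v
      else cavityRec lam 1 e t A v ≤ vacancyProb Γ lam A' v ∧
        vacancyProb Γ lam A' v ≤ cavityRec lam 0 e t A v := by
  induction t generalizing A A' v with
  | zero =>
    simp [cavityRec, (vacancyProb_pos Γ hl A' v).le, vacancyProb_le_one Γ hl A' v]
  | succ t ih =>
    obtain ⟨hnd, hmem⟩ := he A v hv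
    have hv' : v ∈ A' := (hAA' v (hD0 _ v)).1 hv
    -- The list chosen for `A` also enumerates the neighbours of `v` in `A'`, so both sides can be
    -- expanded along the same list.
    have hmem' : ∀ u, u ∈ e A v ↔ u ∈ A' ∧ Γ.Adj v u := fun u => by
      rw [hmem u, and_congr_left_iff]
      exact fun h => hAA' u (hD t v u u h (hD0 t u))
    rw [vacancyProb_eq_inv Γ hl hv' hmem']
    have key := fun i : Fin (e A v).length =>
      ih ((A.erase v) \ ((e A v).take (i : ℕ)).toFinset)
        ((A'.erase v) \ ((e A v).take (i : ℕ)).toFinset) ((e A v).get i) (by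
          have hi := (hmem _).1 ((e A v).get_mem i)
          rw [Finset.mem_sdiff, Finset.mem_erase, List.mem_toFinset]
          -- As the list has no repetition, its `i`-th entry survives the deletion of the earlier
          -- ones.
          refine ⟨⟨hi.2.ne', hi.1⟩, fun h => ?_⟩
          obtain ⟨j, hj, hji⟩ := List.mem_take_iff_getElem.1 h
          have := (hnd.getElem_inj_iff (i := j) (j := i)).1 (by simpa using hji)
          omega)
        (fun u hu => by
          have := hAA' u (hD t v _ u ((hmem _).1 ((e A v).get_mem i)).2 hu)
          simp [this])
    -- Antitonicity of one step; this exchanges the roles of the starting values `0` and `1`.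
    have step : ∀ f g : Fin (e A v).length → ℝ, (∀ i, 0 ≤ f i) → (∀ i, f i ≤ g i) →
        (1 + lam * ∏ i, g i)⁻¹ ≤ (1 + lam * ∏ i, f i)⁻¹ := fun f g hf hfg => by
      have h0 : 0 ≤ ∏ i, f i := Finset.prod_nonneg fun i _ => hf i
      have h1 : ∏ i, f i ≤ ∏ i, g i := Finset.prod_le_prod (fun i _ => hf i) fun i _ => hfg i
      gcongr
    have hq := fun A v => (vacancyProb_pos Γ hl A v).le
    rw [cavityRec, cavityRec]
    by_cases h : Even t
    · rw [if_neg (by simpa [Nat.even_add_one] using h)]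
      simp only [if_pos h] at key
      exact ⟨step _ _ (fun i => hq _ _) fun i => (key i).2,
        step _ _ (fun i => cavityRec_nonneg hl le_rfl _ _ _ _) fun i => (key i).1⟩
    · rw [if_pos (by simpa [Nat.even_add_one] using h)]
      simp only [if_neg h] at key
      exact ⟨step _ _ (fun i => hq _ _) fun i => (key i).2,
        step _ _ (fun i => cavityRec_nonneg hl zero_le_one _ _ _ _) fun i => (key i).1⟩

open Classical in
/-- The chain rule along a linear order `r`. -/
lemma log_hardCoreZ_eq_sum [DecidableEq V] (hl : 0 ≤ lam) (r : V → V → Prop)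
    [IsStrictTotalOrder V r] (A : Finset V) :
    Real.log (hardCoreZ Γ lam A) =
      ∑ v ∈ A, -Real.log (vacancyProb Γ lam (A.filter fun u => r u v ∨ u = v) v) := by
  let := linearOrderOfSTO r
  induction A using Finset.induction_on_max with
  | empty => simp [hardCoreZ_empty]
  | insert a s hs ih =>
    have ha : a ∉ s := fun h => lt_irrefl _ (hs a h)
    -- A new maximum sees the whole set and changes no earlier predecessor set; its term is `log Z`
    -- of the new set minus `log Z` of `s`.
    have hfa : (insert a s).filter (fun u => r u a ∨ u = a) = insert a s :=
      Finset.filter_true_of_mem fun u hu => (Finset.mem_insert.1 hu).elim Or.inr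
        fun h => Or.inl (hs u h)
    have hfv : ∀ v ∈ s, (insert a s).filter (fun u => r u v ∨ u = v) =
        s.filter (fun u => r u v ∨ u = v) := fun v hv => by
      rw [Finset.filter_insert, if_neg]
      rintro (h | h)
      · exact lt_asymm (α := V) h (hs v hv)
      · exact ha (h ▸ hv)
    have h2 : (insert a s).erase a = s := Finset.erase_insert ha
    rw [Finset.sum_insert ha, hfa, Finset.sum_congr rfl fun v hv => by rw [hfv v hv], ← ih,
      vacancyProb, h2, Real.log_div (hardCoreZ_pos Γ hl _).ne' (hardCoreZ_pos Γ hl _).ne']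
    ring

end HardCore

/-! ### Lexicographic order, translations and collars in the lattice. -/

section Lattice

variable {d : ℕ}

lemma mem_latticeBall {r : ℕ} {v : Fin d → ℤ} : v ∈ latticeBall d r ↔ ∑ j, |v j| ≤ (r : ℤ) := by
  simp only [latticeBall, Finset.mem_filter, Fintype.mem_piFinset, Finset.mem_Icc,
    and_iff_right_iff_imp]
  intro h j
  rw [← abs_le]
  exact (Finset.single_le_sum (f := fun j => |v j|) (fun i _ => abs_nonneg _)
    (Finset.mem_univ j)).trans h

lemma mem_halfBall {n : ℕ} {v : Fin d → ℤ} :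
    v ∈ halfBall d n ↔ ∑ j, |v j| ≤ (n : ℤ) ∧ (LexPrec v 0 ∨ v = 0) := by
  classical
  rw [halfBall, Finset.mem_filter, mem_latticeBall]

/-- The largest coordinate at which two points differ decides. The chain rule runs along this order
because it is translation invariant: all predecessor sets are translates of one half-space. -/
instance lexPrec_isStrictTotalOrder : IsStrictTotalOrder (Fin d → ℤ) LexPrec where
  irrefl := fun v ⟨k, h, _⟩ => lt_irrefl _ h
  trans := by
    rintro u v w ⟨k, h, hk⟩ ⟨l, h', hl⟩
    rcases lt_trichotomy k l with hkl | rfl | hkl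
    · exact ⟨l, hk l hkl ▸ h', fun j hj => (hk j (hkl.trans hj)).trans (hl j hj)⟩
    · exact ⟨k, h.trans h', fun j hj => (hk j hj).trans (hl j hj)⟩
    · exact ⟨k, hl k hkl ▸ h, fun j hj => (hk j hj).trans (hl j (hkl.trans hj))⟩
  trichotomous := by
    intro u v huv hvu
    by_contra hne
    have hn : (Finset.univ.filter fun k => u k ≠ v k).Nonempty := by
      obtain ⟨k, hk⟩ := Function.ne_iff.1 hne
      exact ⟨k, by simpa using hk⟩
    obtain ⟨k, hk, hmax⟩ := Finset.exists_max_image _ id hn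
    have heq : ∀ j, k < j → u j = v j := fun j hj => by
      by_contra h
      exact (hmax j (by simpa using h)).not_gt hj
    rcases lt_or_gt_of_ne (Finset.mem_filter.1 hk).2 with h | h
    · exact huv ⟨k, h, heq⟩
    · exact hvu ⟨k, h, fun j hj => (heq j hj).symm⟩

/-- Translation by `w` as an automorphism of the lattice graph. -/
def latticeShift (w : Fin d → ℤ) : latticeGraph d ≃g latticeGraph d where
  toEquiv := Equiv.addRight w
  map_rel_iff' := by simp [latticeGraph]

lemma mem_map_latticeShift {w u : Fin d → ℤ} {A : Finset (Fin d → ℤ)} :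
    u ∈ A.map (latticeShift w).toEquiv.toEmbedding ↔ u - w ∈ A := by
  simp only [Finset.mem_map, latticeShift]
  constructor
  · rintro ⟨a, ha, rfl⟩
    simpa using ha
  · exact fun h => ⟨_, h, by simp⟩

open Classical in
/-- The points of `Λ` within distance `r` of the complement of `Λ`. -/
noncomputable def collar (r : ℕ) (Λ : Finset (Fin d → ℤ)) : Finset (Fin d → ℤ) :=
  Λ.filter fun v => ∃ u, ∑ j, |u j - v j| ≤ (r : ℤ) ∧ u ∉ Λ

/-- Walk from `u` towards `v`, one unit step at a time: the distance to `v` decreases, and the first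
point met in `Λ` has its predecessor on the walk outside `Λ`. -/
lemma exists_mem_innerBoundary {Λ : Finset (Fin d → ℤ)} {v : Fin d → ℤ} (hv : v ∈ Λ) (m : ℕ)
    (u : Fin d → ℤ) (hu : u ∉ Λ) (hm : ∑ j, |u j - v j| ≤ (m : ℤ)) :
    ∃ w ∈ innerBoundary (latticeGraph d) Λ, ∑ j, |w j - v j| ≤ (m : ℤ) := by
  classical
  induction m generalizing u with
  | zero =>
    have h0 := (Finset.sum_eq_zero_iff_of_nonneg fun j _ => abs_nonneg (u j - v j)).1
      (le_antisymm (by simpa using hm) (Finset.sum_nonneg fun j _ => abs_nonneg _))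
    have : u = v := funext fun j => by
      have := h0 j (Finset.mem_univ j)
      rwa [abs_eq_zero, sub_eq_zero] at this
    exact absurd (this ▸ hv) hu
  | succ m ih =>
    obtain ⟨k, hk⟩ := Function.ne_iff.1 fun h : u = v => hu (h ▸ hv)
    -- `s` is the sign of `v k - u k`.
    obtain ⟨s, hs1, hs2⟩ : ∃ s : ℤ, |s| = 1 ∧ |u k + s - v k| = |u k - v k| - 1 := by
      rcases lt_or_gt_of_ne hk with h | h
      · refine ⟨1, by simp, ?_⟩
        rw [abs_of_nonpos (by omega), abs_of_nonpos (by omega)]; ring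
      · refine ⟨-1, by simp, ?_⟩
        rw [abs_of_nonneg (by omega), abs_of_nonneg (by omega)]; ring
    set u' := Function.update u k (u k + s) with hu'
    have hadj : (latticeGraph d).Adj u' u := by
      change ∑ j, |u' j - u j| = 1
      rw [Finset.sum_eq_single k]
      · simp [hu', hs1]
      · intro j _ hj; simp [hu', hj]
      · simp
    have hdist : ∑ j, |u' j - v j| = ∑ j, |u j - v j| - 1 := by
      rw [← Finset.add_sum_erase _ _ (Finset.mem_univ k),
        ← Finset.add_sum_erase (a := k) _ (fun j => |u j - v j|) (Finset.mem_univ k)]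
      have : ∀ j ∈ Finset.univ.erase k, |u' j - v j| = |u j - v j| := fun j hj => by
        rw [hu', Function.update_of_ne (Finset.ne_of_mem_erase hj)]
      rw [Finset.sum_congr rfl this]
      simp only [hu', Function.update_self, hs2]
      ring
    push_cast at hm
    by_cases hmem : u' ∈ Λ
    · refine ⟨u', ?_, by push_cast; omega⟩
      exact Finset.mem_filter.2 ⟨hmem, u, hadj, hu⟩
    · obtain ⟨w, hw, hwm⟩ := ih u' hmem (by omega)
      exact ⟨w, hw, by push_cast; omega⟩

/-- Balls of radius `r` around the inner boundary cover the collar. -/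
lemma card_collar_le (r : ℕ) (Λ : Finset (Fin d → ℤ)) :
    (collar r Λ).card ≤ (innerBoundary (latticeGraph d) Λ).card * (latticeBall d r).card := by
  classical
  have hsub : collar r Λ ⊆ (innerBoundary (latticeGraph d) Λ).biUnion fun w =>
      (latticeBall d r).map (latticeShift w).toEquiv.toEmbedding := by
    intro v hv
    obtain ⟨hv, u, hu, huΛ⟩ := Finset.mem_filter.1 hv
    obtain ⟨w, hw, hwr⟩ := exists_mem_innerBoundary hv r u huΛ hu
    refine Finset.mem_biUnion.2 ⟨w, hw, mem_map_latticeShift.2 (mem_latticeBall.2 ?_)⟩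
    simpa only [Pi.sub_apply, abs_sub_comm] using hwr
  refine (Finset.card_le_card hsub).trans (Finset.card_biUnion_le_card_mul _ _ _ fun w _ => ?_)
  rw [Finset.card_map]

lemma IsExhaustion.tendsto_collar {Λ : ℕ → Finset (Fin d → ℤ)} (h : IsExhaustion d Λ) (r : ℕ) :
    Filter.Tendsto (fun n => ((collar r (Λ n)).card : ℝ) / ((Λ n).card : ℝ))
      Filter.atTop (nhds 0) := by
  have h1 := h.boundary.mul_const ((latticeBall d r).card : ℝ)
  rw [zero_mul] at h1
  refine squeeze_zero (fun n => by positivity) (fun n => ?_) h1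
  rw [div_mul_eq_mul_div]
  gcongr
  exact_mod_cast card_collar_le r (Λ n)

lemma IsExhaustion.card_pos {Λ : ℕ → Finset (Fin d → ℤ)} (h : IsExhaustion d Λ) (n : ℕ) :
    0 < (Λ n).card :=
  Finset.card_pos.2 ⟨0, h.mono (Nat.zero_le n) h.zero_mem⟩

open Classical in
/-- Deep inside `Λ`, the vacancy probabilities of the chain rule along the lexicographic order
are bounded by the recursion on the half-space. -/
lemma cavityRec_halfBall_bounds {lam : ℝ} (hl : 0 ≤ lam)
    {e : Finset (Fin d → ℤ) → (Fin d → ℤ) → List (Fin d → ℤ)} (he : IsNbrEnum (latticeGraph d) e)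
    {t n : ℕ} (htn : t ≤ n) {Λ : Finset (Fin d → ℤ)} {v : Fin d → ℤ} (hv : v ∈ Λ \ collar n Λ) :
    if Even t then
      cavityRec lam 0 e t (halfBall d n) 0 ≤
          vacancyProb (latticeGraph d) lam (Λ.filter fun u => LexPrec u v ∨ u = v) v ∧
        vacancyProb (latticeGraph d) lam (Λ.filter fun u => LexPrec u v ∨ u = v) v ≤
          cavityRec lam 1 e t (halfBall d n) 0
    else
      cavityRec lam 1 e t (halfBall d n) 0 ≤
          vacancyProb (latticeGraph d) lam (Λ.filter fun u => LexPrec u v ∨ u = v) v ∧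
        vacancyProb (latticeGraph d) lam (Λ.filter fun u => LexPrec u v ∨ u = v) v ≤
          cavityRec lam 0 e t (halfBall d n) 0 := by
  have hin : ∀ u, ∑ j, |u j - v j| ≤ (n : ℤ) → u ∈ Λ := fun u hu => by
    by_contra h
    rw [Finset.mem_sdiff] at hv
    exact hv.2 (Finset.mem_filter.2 ⟨hv.1, u, hu, h⟩)
  -- Move `v` to the origin, where the half-ball lives.
  rw [← vacancyProb_map _ (latticeShift (-v)), show latticeShift (-v) v = 0 from add_neg_cancel v]
  refine cavityRec_bounds (latticeGraph d) hl he
    (D := fun t v u => ∑ j, |u j - v j| ≤ (t : ℤ)) (by simp) ?_ t _ _ 0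
    (mem_halfBall.2 (by simp)) ?_
  · intro t v u w hvu huw
    change ∑ j, |v j - u j| = 1 at hvu
    calc ∑ j, |w j - v j| ≤ ∑ j, (|w j - u j| + |v j - u j|) :=
          Finset.sum_le_sum fun j _ => by
            rw [abs_sub_comm (v j)]; exact abs_sub_le _ _ _
      _ ≤ _ := by rw [Finset.sum_add_distrib, hvu]; push_cast; omega
  -- Within distance `t ≤ n` of the origin, membership in the translate of `Λ` is automatic, as `v`
  -- avoids the collar; only the order condition remains.
  · intro u hu
    simp only [Pi.zero_apply, sub_zero] at hu
    have hun : ∑ j, |u j| ≤ (n : ℤ) := hu.trans (by exact_mod_cast htn)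
    have huv : u - -v ∈ Λ := hin _ (by simpa using hun)
    have hlex : LexPrec (u - -v) v ↔ LexPrec u 0 := by
      simp [LexPrec]
    rw [mem_halfBall, mem_map_latticeShift, Finset.mem_filter, hlex]
    simp only [hun, huv, true_and]
    simp [add_eq_right]

/-- Collar terms of the chain rule are nonnegative and are dropped. Describing `B` by membership
keeps decidability instances out of the statement. -/
lemma mul_sub_le_log_hardCoreZ {lam a : ℝ} (hl : 0 ≤ lam) {Λ : Finset (Fin d → ℤ)} {n : ℕ}
    (h : ∀ v ∈ Λ \ collar n Λ, ∀ B : Finset (Fin d → ℤ),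
      (∀ u, u ∈ B ↔ u ∈ Λ ∧ (LexPrec u v ∨ u = v)) →
      a ≤ -Real.log (vacancyProb (latticeGraph d) lam B v)) :
    a * Λ.card - a * (collar n Λ).card ≤ Real.log (hardCoreZ (latticeGraph d) lam Λ) := by
  classical
  have hsub : collar n Λ ⊆ Λ := Finset.filter_subset _ _
  rw [log_hardCoreZ_eq_sum _ hl LexPrec, ← Finset.sum_sdiff hsub]
  have h1 := Finset.card_nsmul_le_sum (Λ \ collar n Λ) _ a fun v hv =>
    h v hv (Λ.filter fun u => LexPrec u v ∨ u = v) (by simp)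
  have h2 : 0 ≤ ∑ v ∈ collar n Λ, -Real.log
      (vacancyProb (latticeGraph d) lam (Λ.filter fun u => LexPrec u v ∨ u = v) v) :=
    Finset.sum_nonneg fun v _ => neg_nonneg.2
      (Real.log_nonpos (vacancyProb_pos _ hl _ _).le (vacancyProb_le_one _ hl _ _))
  rw [nsmul_eq_mul, Finset.cast_card_sdiff hsub] at h1
  linarith

/-- Each collar term is at most `log (1 + lam)`, because a vacancy probability is at least `(1 +
lam)⁻¹`. -/
lemma log_hardCoreZ_le_mul_add {lam b : ℝ} (hl : 0 ≤ lam) {Λ : Finset (Fin d → ℤ)} {n : ℕ}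
    (h : ∀ v ∈ Λ \ collar n Λ, ∀ B : Finset (Fin d → ℤ),
      (∀ u, u ∈ B ↔ u ∈ Λ ∧ (LexPrec u v ∨ u = v)) →
      -Real.log (vacancyProb (latticeGraph d) lam B v) ≤ b) :
    Real.log (hardCoreZ (latticeGraph d) lam Λ) ≤
      b * Λ.card + (Real.log (1 + lam) - b) * (collar n Λ).card := by
  classical
  have hsub : collar n Λ ⊆ Λ := Finset.filter_subset _ _
  rw [log_hardCoreZ_eq_sum _ hl LexPrec, ← Finset.sum_sdiff hsub]
  have h1 := Finset.sum_le_card_nsmul (Λ \ collar n Λ) _ b fun v hv =>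
    h v hv (Λ.filter fun u => LexPrec u v ∨ u = v) (by simp)
  have h2 := Finset.sum_le_card_nsmul (collar n Λ) (fun v => -Real.log
      (vacancyProb (latticeGraph d) lam (Λ.filter fun u => LexPrec u v ∨ u = v) v))
      (Real.log (1 + lam)) fun v hv => by
    rw [neg_le, ← Real.log_inv]
    exact Real.log_le_log (by positivity)
      (inv_le_vacancyProb _ hl (Finset.mem_filter.2 ⟨hsub hv, Or.inr rfl⟩))
  rw [nsmul_eq_mul, Finset.cast_card_sdiff hsub] at h1
  rw [nsmul_eq_mul] at h2
  linarith

lemma IsExhaustion.tendsto_const_add_collar {Λ : ℕ → Finset (Fin d → ℤ)} (h : IsExhaustion d Λ)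
    (r : ℕ) (a C : ℝ) :
    Filter.Tendsto (fun n => (a * (Λ n).card + C * (collar r (Λ n)).card) / ((Λ n).card : ℝ))
      Filter.atTop (nhds a) := by
  have h1 := (h.tendsto_collar r).const_mul C |>.const_add a
  rw [mul_zero, add_zero] at h1
  refine h1.congr fun n => ?_
  have : ((Λ n).card : ℝ) ≠ 0 := by exact_mod_cast (h.card_pos n).ne'
  field_simp

/-! ### Centred cubes as an exhaustion. -/

/-- The centred cube of side `2 * n + 1`. -/
noncomputable def centredCube (d n : ℕ) : Finset (Fin d → ℤ) :=
  Fintype.piFinset fun _ => Finset.Icc (-(n : ℤ)) n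

lemma mem_centredCube {n : ℕ} {v : Fin d → ℤ} : v ∈ centredCube d n ↔ ∀ j, |v j| ≤ n := by
  simp [centredCube, abs_le]

lemma card_centredCube (n : ℕ) : (centredCube d n).card = (2 * n + 1) ^ d := by
  rw [centredCube, Fintype.card_piFinset_const, Int.card_Icc]
  congr 1
  omega

lemma abs_sub_le_one_of_adj {u v : Fin d → ℤ} (h : (latticeGraph d).Adj u v) (j : Fin d) :
    |u j - v j| ≤ 1 :=
  (Finset.single_le_sum (f := fun j => |u j - v j|) (fun _ _ => abs_nonneg _)
    (Finset.mem_univ j)).trans h.le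

lemma centredCube_isExhaustion (d : ℕ) : IsExhaustion d (centredCube d) where
  zero_mem := by simp [mem_centredCube]
  mono := fun m n hmn v hv => by
    rw [mem_centredCube] at *
    exact fun j => (hv j).trans (by exact_mod_cast hmn)
  ball_subset := fun r => by
    filter_upwards [Filter.eventually_ge_atTop r] with n hn v hv
    rw [mem_centredCube]
    intro j
    exact ((Finset.single_le_sum (f := fun j => |v j|) (fun i _ => abs_nonneg _)
      (Finset.mem_univ j)).trans (mem_latticeBall.1 hv)).trans (by exact_mod_cast hn)
  boundary := by
    classical
    rw [← Filter.tendsto_add_atTop_iff_nat 1]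
    -- The inner boundary of cube `n + 1` lies in the shell outside cube `n`, whose density is `1 -
    -- ((2n+1)/(2n+3))^d`.
    have hlim : Filter.Tendsto (fun n : ℕ => 1 - (1 - 2 * (1 / ((2 * n + 3 : ℕ) : ℝ))) ^ d)
        Filter.atTop (nhds 0) := by
      have h1 : Filter.Tendsto (fun n : ℕ => 1 / ((2 * n + 3 : ℕ) : ℝ))
          Filter.atTop (nhds 0) :=
        tendsto_const_nhds.div_atTop (tendsto_natCast_atTop_atTop.comp
          (Filter.tendsto_atTop_mono (fun n => by rw [id]; omega) Filter.tendsto_id))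
      simpa using (((h1.const_mul 2).const_sub 1).pow d).const_sub 1
    refine squeeze_zero (fun n => by positivity) (fun n => ?_) hlim
    have hsub : centredCube d n ⊆ centredCube d (n + 1) := fun v hv => by
      rw [mem_centredCube] at *
      exact fun j => (hv j).trans (by push_cast; omega)
    have hbd : innerBoundary (latticeGraph d) (centredCube d (n + 1)) ⊆
        centredCube d (n + 1) \ centredCube d n := by
      intro v hv
      obtain ⟨hv, u, hadj, hu⟩ := Finset.mem_filter.1 hv
      refine Finset.mem_sdiff.2 ⟨hv, fun h => hu ?_⟩
      rw [mem_centredCube] at h ⊢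
      intro j
      have h1 := abs_sub_le_one_of_adj hadj j
      have h2 := h j
      rw [abs_le] at *
      push_cast
      omega
    have hcard := Finset.card_le_card hbd
    have hc : ((innerBoundary (latticeGraph d) (centredCube d (n + 1))).card : ℝ) ≤
        (2 * n + 3) ^ d - (2 * n + 1) ^ d := by
      refine (Nat.cast_le (α := ℝ).2 hcard).trans ?_
      rw [Finset.cast_card_sdiff hsub, card_centredCube, card_centredCube]
      push_cast
      apply le_of_eq
      ring
    rw [card_centredCube]
    push_cast
    have h3 : (0 : ℝ) < 2 * n + 3 := by positivity
    rw [show (2 * ((n : ℝ) + 1) + 1) = 2 * n + 3 by ring, div_le_iff₀ (by positivity),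
      sub_mul, ← mul_pow, one_mul]
    rwa [show (1 - 2 * (1 / (2 * (n : ℝ) + 3))) * (2 * n + 3) = 2 * n + 1 by field_simp; ring]

end Lattice

/-! ### Partition functions of families of disjoint sets. -/

section Biunion

variable {V : Type*} (Γ : SimpleGraph V) {lam : ℝ}

lemma hardCoreZ_biUnion_le [DecidableEq V] {ι : Type*} (hl : 0 ≤ lam)
    (K : Finset ι) (Q : ι → Finset V) (hQ : ∀ k l, k ≠ l → Disjoint (Q k) (Q l)) :
    hardCoreZ Γ lam (K.biUnion Q) ≤ ∏ k ∈ K, hardCoreZ Γ lam (Q k) := by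
  classical
  induction K using Finset.induction_on with
  | empty => simp [hardCoreZ_empty]
  | insert k K hk ih =>
    rw [Finset.biUnion_insert, Finset.prod_insert hk]
    refine (hardCoreZ_union_le Γ hl ?_).trans
      (mul_le_mul_of_nonneg_left ih (hardCoreZ_pos Γ hl _).le)
    exact (Finset.disjoint_biUnion_right _ _ _).2 fun l hlK => hQ k l fun h => hk (h ▸ hlK)

lemma hardCoreZ_biUnion_eq [DecidableEq V] {ι : Type*}
    (K : Finset ι) (Q : ι → Finset V) (hQ : ∀ k l, k ≠ l → Disjoint (Q k) (Q l))
    (hadj : ∀ k l, k ≠ l → ∀ a ∈ Q k, ∀ b ∈ Q l, ¬ Γ.Adj a b) :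
    hardCoreZ Γ lam (K.biUnion Q) = ∏ k ∈ K, hardCoreZ Γ lam (Q k) := by
  classical
  induction K using Finset.induction_on with
  | empty => simp [hardCoreZ_empty]
  | insert k K hk ih =>
    have hne : ∀ l ∈ K, k ≠ l := fun l hlK h => hk (h ▸ hlK)
    rw [Finset.biUnion_insert, Finset.prod_insert hk, hardCoreZ_union_eq, ih]
    · exact (Finset.disjoint_biUnion_right _ _ _).2 fun l hlK => hQ k l (hne l hlK)
    · intro a ha b hb
      obtain ⟨l, hlK, hb⟩ := Finset.mem_biUnion.1 hb
      exact hadj k l (hne l hlK) a ha b hb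

end Biunion

/-! ### Existence of the free energy by tiling. -/

section Tiling

variable {d : ℕ} {lam : ℝ}

/-- The cube of side `m` with lowest corner `a`. -/
noncomputable def cornerCube (m : ℕ) (a : Fin d → ℤ) : Finset (Fin d → ℤ) :=
  Fintype.piFinset fun j => Finset.Ico (a j) (a j + m)

lemma mem_cornerCube {m : ℕ} {a v : Fin d → ℤ} :
    v ∈ cornerCube m a ↔ ∀ j, a j ≤ v j ∧ v j < a j + m := by
  simp [cornerCube]

lemma card_cornerCube (m : ℕ) (a : Fin d → ℤ) : (cornerCube m a).card = m ^ d := by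
  simp [cornerCube, Fintype.card_piFinset]

lemma cornerCube_subset {m n : ℕ} (h : m ≤ n) (a : Fin d → ℤ) :
    cornerCube m a ⊆ cornerCube n a := fun v hv => by
  rw [mem_cornerCube] at *
  intro j
  have := hv j
  omega

lemma hardCoreZ_cornerCube (m : ℕ) (a : Fin d → ℤ) :
    hardCoreZ (latticeGraph d) lam (cornerCube m a) =
      hardCoreZ (latticeGraph d) lam (cornerCube m 0) := by
  rw [← hardCoreZ_map _ (latticeShift a) (cornerCube m 0)]
  congr 1
  ext v
  rw [mem_map_latticeShift, mem_cornerCube, mem_cornerCube]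
  refine forall_congr' fun j => ?_
  simp only [Pi.sub_apply, Pi.zero_apply]
  omega

/-- The lowest corner of the tile with index `k` in the tiling by cubes of side `L`. -/
def tileCorner (L : ℕ) (k : Fin d → ℤ) : Fin d → ℤ := fun j => k j * L

/-- Used twice: with `v = u` and `m ≤ L` it makes tiles disjoint; with `m = L - 1` and coordinates
differing by at most `1` it makes shrunken tiles non-adjacent. -/
lemma tile_index_eq {L : ℕ} {k l v u : Fin d → ℤ} {m : ℕ}
    (hv : v ∈ cornerCube m (tileCorner L k)) (hu : u ∈ cornerCube m (tileCorner L l))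
    (h : ∀ j, |v j - u j| + m ≤ L) : k = l := by
  rw [mem_cornerCube] at hv hu
  funext j
  have h1 := hv j
  have h2 := hu j
  have h3 := h j
  simp only [tileCorner] at h1 h2
  have h4 := le_abs_self (v j - u j)
  have h5 := neg_abs_le (v j - u j)
  by_contra hne
  rcases lt_or_gt_of_ne hne with hlt | hlt
  · have : (k j + 1) * L ≤ l j * L := mul_le_mul_of_nonneg_right hlt (by positivity)
    linarith
  · have : (l j + 1) * L ≤ k j * L := mul_le_mul_of_nonneg_right hlt (by positivity)
    linarith

lemma disjoint_tiles {L m : ℕ} (hmL : m ≤ L) {k l : Fin d → ℤ} (hkl : k ≠ l) :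
    Disjoint (cornerCube m (tileCorner L k)) (cornerCube m (tileCorner L l)) :=
  Finset.disjoint_left.2 fun v hv hu => hkl (tile_index_eq hv hu fun j => by simpa using hmL)

lemma not_adj_tiles {M : ℕ} {k l : Fin d → ℤ} (hkl : k ≠ l) :
    ∀ a ∈ cornerCube M (tileCorner (M + 1) k), ∀ b ∈ cornerCube M (tileCorner (M + 1) l),
      ¬ (latticeGraph d).Adj a b := fun a ha b hb hadj =>
  hkl (tile_index_eq ha hb fun j => by
    have := abs_sub_le_one_of_adj hadj j
    push_cast
    omega)

lemma mem_tile (M : ℕ) (v : Fin d → ℤ) :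
    v ∈ cornerCube (M + 1) (tileCorner (M + 1) fun j => v j / ((M + 1 : ℕ) : ℤ)) := by
  rw [mem_cornerCube]
  intro j
  have hpos : (0 : ℤ) < ((M + 1 : ℕ) : ℤ) := by positivity
  exact ⟨Int.ediv_mul_le _ hpos.ne', by
    have := Int.lt_ediv_add_one_mul_self (v j) hpos
    simp only [tileCorner]
    linarith⟩

/-- The number of tiles inside `Λ` nearly exhausts `Λ`, and their union is contained in `Λ`. -/
lemma exists_tiles (M : ℕ) (Λ : Finset (Fin d → ℤ)) :
    ∃ K : Finset (Fin d → ℤ),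
      K.biUnion (fun k => cornerCube (M + 1) (tileCorner (M + 1) k)) ⊆ Λ ∧
      Λ \ collar (d * (M + 1)) Λ ⊆
        K.biUnion (fun k => cornerCube (M + 1) (tileCorner (M + 1) k)) := by
  classical
  -- The tiles that meet `Λ` and lie inside it. A tile has `ℓ¹` diameter at most `d * (M + 1)`, so
  -- the tile of a point off the collar qualifies.
  refine ⟨(Λ.image fun v j => v j / ((M + 1 : ℕ) : ℤ)).filter
    fun k => cornerCube (M + 1) (tileCorner (M + 1) k) ⊆ Λ, ?_, ?_⟩
  · exact Finset.biUnion_subset.2 fun k hk => (Finset.mem_filter.1 hk).2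
  · intro v hv
    rw [Finset.mem_sdiff] at hv
    refine Finset.mem_biUnion.2 ⟨_, Finset.mem_filter.2
      ⟨Finset.mem_image_of_mem _ hv.1, fun u hu => ?_⟩, mem_tile M v⟩
    by_contra h
    refine hv.2 (Finset.mem_filter.2 ⟨hv.1, u, ?_, h⟩)
    have h1 := mem_cornerCube.1 (mem_tile M v)
    have h2 := mem_cornerCube.1 hu
    calc ∑ j, |u j - v j| ≤ ∑ _j : Fin d, ((M + 1 : ℕ) : ℤ) :=
          Finset.sum_le_sum fun j _ => by
            have h1 := h1 j
            have h2 := h2 j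
            rw [abs_le]
            constructor <;> linarith
      _ = _ := by simp

/-- `log Z` of the cube of side `m`. -/
noncomputable def logZCube (d : ℕ) (lam : ℝ) (m : ℕ) : ℝ :=
  Real.log (hardCoreZ (latticeGraph d) lam (cornerCube m 0))

lemma logZCube_nonneg (hl : 0 ≤ lam) (m : ℕ) : 0 ≤ logZCube d lam m :=
  Real.log_nonneg (one_le_hardCoreZ _ hl _)

lemma log_hardCoreZ_le_card (hl : 0 ≤ lam) (A : Finset (Fin d → ℤ)) :
    Real.log (hardCoreZ (latticeGraph d) lam A) ≤ A.card * Real.log (1 + lam) := by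
  rw [← Real.log_pow]
  exact Real.log_le_log (hardCoreZ_pos _ hl A) (hardCoreZ_le_pow _ hl A)

lemma log_hardCoreZ_le_add_sdiff (hl : 0 ≤ lam) {A B : Finset (Fin d → ℤ)} (h : A ⊆ B) :
    Real.log (hardCoreZ (latticeGraph d) lam B) ≤
      Real.log (hardCoreZ (latticeGraph d) lam A) + ((B.card : ℝ) - A.card) * Real.log (1 + lam) := by
  have h1 := hardCoreZ_union_le (latticeGraph d) hl (Finset.disjoint_sdiff (s := A) (t := B))
  rw [Finset.union_sdiff_of_subset h] at h1
  have h2 := Real.log_le_log (hardCoreZ_pos _ hl B) h1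
  rw [Real.log_mul (hardCoreZ_pos _ hl _).ne' (hardCoreZ_pos _ hl _).ne'] at h2
  have h3 := log_hardCoreZ_le_card hl (B \ A)
  rw [Finset.cast_card_sdiff h] at h3
  linarith

/-- The surface-layer cost that closes the gap between the lower and upper tiling rates. -/
lemma logZCube_succ_le (hl : 0 ≤ lam) (M : ℕ) :
    logZCube d lam (M + 1) ≤ logZCube d lam M +
      (((M : ℝ) + 1) ^ d - (M : ℝ) ^ d) * Real.log (1 + lam) := by
  have := log_hardCoreZ_le_add_sdiff hl (cornerCube_subset (Nat.le_succ M) (0 : Fin d → ℤ))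
  rw [card_cornerCube, card_cornerCube] at this
  push_cast at this
  exact this

/-- Tiling by cubes of side `M + 1` determines `log Z_Λ` up to boundary terms. -/
lemma log_hardCoreZ_tiling (hl : 0 ≤ lam) (M : ℕ) (Λ : Finset (Fin d → ℤ)) :
    logZCube d lam M / ((M : ℝ) + 1) ^ d * Λ.card +
        (-(logZCube d lam M / ((M : ℝ) + 1) ^ d)) * (collar (d * (M + 1)) Λ).card ≤
      Real.log (hardCoreZ (latticeGraph d) lam Λ) ∧
    Real.log (hardCoreZ (latticeGraph d) lam Λ) ≤
      logZCube d lam (M + 1) / ((M : ℝ) + 1) ^ d * Λ.card +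
        Real.log (1 + lam) * (collar (d * (M + 1)) Λ).card := by
  classical
  obtain ⟨K, hKΛ, hΛK⟩ := exists_tiles M Λ
  set G := K.biUnion fun k => cornerCube (M + 1) (tileCorner (M + 1) k) with hG
  -- Empty corridors of width one separate these shrunken tiles, so their partition function
  -- factorises exactly.
  set G' := K.biUnion fun k => cornerCube M (tileCorner (M + 1) k) with hG'
  have hcardG : (G.card : ℝ) = K.card * ((M : ℝ) + 1) ^ d := by
    rw [hG, Finset.card_biUnion fun k _ l _ hkl => disjoint_tiles le_rfl hkl]
    simp [card_cornerCube]
  have hM : (0 : ℝ) < ((M : ℝ) + 1) ^ d := by positivity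
  have hsub : collar (d * (M + 1)) Λ ⊆ Λ := Finset.filter_subset _ _
  have hGle : (G.card : ℝ) ≤ Λ.card := by exact_mod_cast Finset.card_le_card hKΛ
  have hleG : (Λ.card : ℝ) - (collar (d * (M + 1)) Λ).card ≤ G.card := by
    rw [← Finset.cast_card_sdiff hsub]
    exact_mod_cast Finset.card_le_card hΛK
  have hG'G : G' ⊆ G := Finset.biUnion_mono fun k _ => cornerCube_subset (Nat.le_succ M) _
  constructor
  · have h1 : Real.log (hardCoreZ (latticeGraph d) lam G') = K.card * logZCube d lam M := by
      rw [hG', hardCoreZ_biUnion_eq _ K _ (fun k l hkl => disjoint_tiles (Nat.le_succ M) hkl)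
        fun k l hkl => not_adj_tiles hkl]
      simp only [hardCoreZ_cornerCube, Finset.prod_const, Real.log_pow, logZCube]
    have h2 := Real.log_le_log (hardCoreZ_pos _ hl G')
      (hardCoreZ_mono (latticeGraph d) hl (hG'G.trans hKΛ))
    refine le_trans ?_ (h1.symm.le.trans h2)
    rw [neg_mul, ← sub_eq_add_neg, ← mul_sub]
    refine (mul_le_mul_of_nonneg_left hleG (div_nonneg (logZCube_nonneg hl M) hM.le)).trans ?_
    rw [hcardG]
    apply le_of_eq
    field_simp
  · have h1 : Real.log (hardCoreZ (latticeGraph d) lam G) ≤ K.card * logZCube d lam (M + 1) := by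
      have := hardCoreZ_biUnion_le (latticeGraph d) hl K _
        fun k l hkl => disjoint_tiles (le_refl (M + 1)) hkl
      refine (Real.log_le_log (hardCoreZ_pos _ hl G) this).trans_eq ?_
      simp only [hardCoreZ_cornerCube, Finset.prod_const, Real.log_pow, logZCube]
    refine (log_hardCoreZ_le_add_sdiff hl hKΛ).trans (add_le_add (h1.trans ?_) ?_)
    · have : (K.card : ℝ) * logZCube d lam (M + 1) =
          logZCube d lam (M + 1) / ((M : ℝ) + 1) ^ d * G.card := by
        rw [hcardG]; field_simp
      rw [this]
      exact mul_le_mul_of_nonneg_left hGle (div_nonneg (logZCube_nonneg hl _) hM.le)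
    · rw [mul_comm]
      exact mul_le_mul_of_nonneg_left (by linarith) (Real.log_nonneg (by linarith))

/-- The free energy of the hard-core model on `ℤ^d` exists at every activity. -/
theorem exists_isFreeEnergy (d : ℕ) (hl : 0 ≤ lam) : ∃ p : ℝ, IsFreeEnergy d lam p := by
  set f : ℕ → ℝ := fun M => logZCube d lam (M + 1) / ((M : ℝ) + 1) ^ d with hf
  have hbdd : BddBelow (Set.range f) := ⟨0, by
    rintro _ ⟨M, rfl⟩
    exact div_nonneg (logZCube_nonneg hl _) (by positivity)⟩
  refine ⟨⨅ M, f M, fun Λ hΛ => tendsto_order.2 ⟨fun a ha => ?_, fun b hb => ?_⟩⟩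
  · have h1 : Filter.Tendsto
        (fun M : ℕ => (1 - (1 - 1 / ((M : ℝ) + 1)) ^ d) * Real.log (1 + lam))
        Filter.atTop (nhds 0) := by
      simpa using (((tendsto_one_div_add_atTop_nhds_zero_nat (𝕜 := ℝ)).const_sub 1).pow d
        |>.const_sub 1).mul_const (Real.log (1 + lam))
    -- `M` is so large that the surface term is below the gap between the infimum and `a`; the lower
    -- tiling rate then exceeds `a`.
    obtain ⟨M, hM⟩ := (h1.eventually_lt_const (sub_pos.2 ha)).exists
    have hpos : (0 : ℝ) < (M : ℝ) + 1 := by positivity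
    have h2 : f M ≤ logZCube d lam M / ((M : ℝ) + 1) ^ d +
        (1 - (1 - 1 / ((M : ℝ) + 1)) ^ d) * Real.log (1 + lam) := by
      rw [show 1 - 1 / ((M : ℝ) + 1) = M / (M + 1) by field_simp; ring, hf]
      refine (div_le_div_of_nonneg_right (logZCube_succ_le hl M) (by positivity)).trans_eq ?_
      rw [div_pow]
      field_simp
    have h3 : a < logZCube d lam M / ((M : ℝ) + 1) ^ d := by
      have := ciInf_le hbdd M
      linarith
    filter_upwards [(hΛ.tendsto_const_add_collar (d * (M + 1)) _
      (-(logZCube d lam M / ((M : ℝ) + 1) ^ d))).eventually_const_lt h3] with n hn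
    exact hn.trans_le (div_le_div_of_nonneg_right (log_hardCoreZ_tiling hl M (Λ n)).1
      (Nat.cast_nonneg _))
  · obtain ⟨M, hM⟩ := exists_lt_of_ciInf_lt hb
    filter_upwards [(hΛ.tendsto_const_add_collar (d * (M + 1)) _
      (Real.log (1 + lam))).eventually_lt_const hM] with n hn
    exact (div_le_div_of_nonneg_right (log_hardCoreZ_tiling hl M (Λ n)).2
      (Nat.cast_nonneg _)).trans_lt hn

end Tiling

/-! ### From vacancy bounds to free energy bounds. -/

section Bounds

variable {d : ℕ} {lam p : ℝ}

lemma negLog_of_pos {x : ℝ} (hx : 0 < x) : negLog x = ((-Real.log x : ℝ) : EReal) := by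
  rw [negLog, ENNReal.log_ofReal_of_pos hx, EReal.coe_neg]

lemma negLog_of_nonpos {x : ℝ} (hx : x ≤ 0) : negLog x = ⊤ := by
  rw [negLog, ENNReal.log_ofReal, if_pos hx, EReal.neg_bot]

/-- An upper bound on the vacancy probabilities deep inside `Λ` bounds the free energy below. -/
lemma IsFreeEnergy.negLog_le (hp : IsFreeEnergy d lam p) (hl : 0 ≤ lam) {x : ℝ} {n : ℕ}
    (hx : 0 < x)
    (h : ∀ (Λ B : Finset (Fin d → ℤ)), ∀ v ∈ Λ \ collar n Λ,
      (∀ u, u ∈ B ↔ u ∈ Λ ∧ (LexPrec u v ∨ u = v)) → vacancyProb (latticeGraph d) lam B v ≤ x) :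
    negLog x ≤ (p : EReal) := by
  rw [negLog_of_pos hx, EReal.coe_le_coe_iff]
  -- The limit `p` is common to all exhaustions, so one suffices for the estimate.
  have hex := centredCube_isExhaustion d
  refine le_of_tendsto_of_tendsto' (hex.tendsto_const_add_collar n (-Real.log x) (Real.log x))
    (hp _ hex) fun m => div_le_div_of_nonneg_right ?_ (Nat.cast_nonneg _)
  have := mul_sub_le_log_hardCoreZ hl (a := -Real.log x) (Λ := centredCube d m) (n := n)
    fun v hv B hB => neg_le_neg (Real.log_le_log (vacancyProb_pos _ hl _ _) (h _ B v hv hB))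
  linarith

/-- A lower bound on the vacancy probabilities deep inside `Λ` bounds the free energy above. -/
lemma IsFreeEnergy.le_negLog (hp : IsFreeEnergy d lam p) (hl : 0 ≤ lam) {x : ℝ} {n : ℕ}
    (h : ∀ (Λ B : Finset (Fin d → ℤ)), ∀ v ∈ Λ \ collar n Λ,
      (∀ u, u ∈ B ↔ u ∈ Λ ∧ (LexPrec u v ∨ u = v)) → x ≤ vacancyProb (latticeGraph d) lam B v) :
    (p : EReal) ≤ negLog x := by
  rcases le_or_gt x 0 with hx | hx
  · rw [negLog_of_nonpos hx]
    exact le_top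
  rw [negLog_of_pos hx, EReal.coe_le_coe_iff]
  have hex := centredCube_isExhaustion d
  refine le_of_tendsto_of_tendsto' (hp _ hex) (hex.tendsto_const_add_collar n (-Real.log x)
    (Real.log (1 + lam) - -Real.log x)) fun m => div_le_div_of_nonneg_right ?_ (Nat.cast_nonneg _)
  exact log_hardCoreZ_le_mul_add hl fun v hv B hB =>
    neg_le_neg (Real.log_le_log hx (h _ B v hv hB))

/-- Needed for `Ψ` at odd depth: its initial value is `0`, but one step makes it positive, as
`IsFreeEnergy.negLog_le` requires. -/
lemma cavityRec_succ_pos {V : Type*} [DecidableEq V] (hl : 0 ≤ lam) {x : ℝ} (hx : 0 ≤ x)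
    (e : Finset V → V → List V) (t : ℕ) (A : Finset V) (v : V) :
    0 < cavityRec lam x e (t + 1) A v := by
  rw [cavityRec, inv_pos]
  have := Finset.prod_nonneg (s := Finset.univ) fun (i : Fin (e A v).length) _ =>
    cavityRec_nonneg hl hx e t ((A.erase v) \ ((e A v).take (i : ℕ)).toFinset)
      ((e A v).get i)
  positivity

lemma cavityRec_pos {V : Type*} [DecidableEq V] (hl : 0 ≤ lam) {x : ℝ} (hx : 0 < x)
    (e : Finset V → V → List V) (t : ℕ) (A : Finset V) (v : V) :
    0 < cavityRec lam x e t A v := by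
  cases t with
  | zero => simpa [cavityRec]
  | succ t => exact cavityRec_succ_pos hl hx.le e t A v

end Bounds

theorem corollary3 (d : ℕ) (hd : 1 ≤ d) (Δ : ℕ) (hΔ : 3 ≤ Δ) (hdΔ : 2 * d ≤ Δ)
    (lam : ℝ) (hlam_pos : 0 < lam)
    (hlam : lam < ((Δ : ℝ) - 1) ^ (Δ - 1) / ((Δ : ℝ) - 2) ^ Δ) :
    ∃ p : ℝ, IsFreeEnergy d lam p ∧
      ∀ e : Finset (Fin d → ℤ) → (Fin d → ℤ) → List (Fin d → ℤ),
        IsNbrEnum (latticeGraph d) e → ∀ t n : ℕ,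
          (2 * t + 1 ≤ n →
            negLog (latticePhi d lam e n (2 * t)) ≤ (p : EReal) ∧
            (p : EReal) ≤ negLog (latticePsi d lam e n (2 * t))) ∧
          (2 * t + 1 + 1 ≤ n →
            negLog (latticePsi d lam e n (2 * t + 1)) ≤ (p : EReal) ∧
            (p : EReal) ≤ negLog (latticePhi d lam e n (2 * t + 1))) := by
  classical
  have hl : 0 ≤ lam := hlam_pos.le
  obtain ⟨p, hp⟩ := exists_isFreeEnergy d hl
  have hB : ∀ (Λ B : Finset (Fin d → ℤ)) (v : Fin d → ℤ),
      (∀ u, u ∈ B ↔ u ∈ Λ ∧ (LexPrec u v ∨ u = v)) →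
      B = Λ.filter fun u => LexPrec u v ∨ u = v := fun Λ B v h => by
    ext u
    rw [h, Finset.mem_filter]
  refine ⟨p, hp, fun e he t n => ⟨fun hn => ?_, fun hn => ?_⟩⟩
  · have key := fun Λ v hv => cavityRec_halfBall_bounds hl he (t := 2 * t) (n := n) (by omega)
      (Λ := Λ) (v := v) hv
    -- At even depth `Φ` bounds vacancies above, hence `p` below; at odd depth `Ψ` takes this role.
    simp only [if_pos (even_two_mul t)] at key
    refine ⟨hp.negLog_le hl (n := n) (cavityRec_pos hl one_pos _ _ _ _) fun Λ B v hv h => ?_,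
      hp.le_negLog hl (n := n) fun Λ B v hv h => ?_⟩
    · rw [hB Λ B v h]
      exact (key Λ v hv).2
    · rw [hB Λ B v h]
      exact (key Λ v hv).1
  · have key := fun Λ v hv => cavityRec_halfBall_bounds hl he (t := 2 * t + 1) (n := n) (by omega)
      (Λ := Λ) (v := v) hv
    simp only [if_neg (Nat.not_even_two_mul_add_one t)] at key
    refine ⟨hp.negLog_le hl (n := n) (cavityRec_succ_pos hl le_rfl _ _ _ _) fun Λ B v hv h => ?_,
      hp.le_negLog hl (n := n) fun Λ B v hv h => ?_⟩
    · rw [hB Λ B v h]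
      exact (key Λ v hv).2
    · rw [hB Λ B v h]
      exact (key Λ v hv).1
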